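/- **Theorem.** For a function $g:\mathbb{R}^n\to\mathbb{R}$ that is bounded below, let $\mathrm{co}[g]$ denote its convex envelope, i.e. the pointwise supremum of all convex functions $h\le g$. For a bounded function $g:\mathbb{R}^n\to\mathbb{R}$ and $\lambda>0$ define the lower and upper compensated convex transforms $$C^l_\lambda(g)(x)=\mathrm{co}\big[\lambda|\cdot|^2+g\big](x)-\lambda|x|^2,\qquad C^u_\lambda(g)(x)=\lambda|x|^2-\mathrm{co}\big[\lambda|\cdot|^2-g\big](x),\qquad x\in\mathbb{R}^n,$$ where $|\cdot|$ is the Euclidean norm. Let $K\subset\mathbb{R}^n$ be a non-empty closed set and let $f_K:K\to\mathbb{R}$ be a (bounded) function with $|f_K(x)|<M$ for all $x\in K$. Let $f_K^{M}$ and $f_K^{-M}$ be the functions on $\mathbb{R}^n$ that equal $f_K$ on $K$ and equal $M$, respectively $-M$, on $\mathbb{R}^n\setminus K$. For $\lambda,\tau>0$ define on $\mathbb{R}^n$ the upper, lower, average and mixed approximations $$U^M_\lambda(f_K)=C^u_\lambda(f_K^{-M}),\qquad L^M_\lambda(f_K)=C^l_\lambda(f_K^{M}),\qquad A^M_\lambda(f_K)=\tfrac12\big(C^l_\lambda(f_K^{M})+C^u_\lambda(f_K^{-M})\big),$$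 $$(SA)^M_{\lambda,\tau}(f_K)=\tfrac12\big(C^u_\tau(C^l_\lambda(f_K^{M}))+C^l_\tau(C^u_\lambda(f_K^{-M}))\big).$$ Then, for all fixed $\lambda>0$ and $\tau>0$: (i) $U^M_\lambda(f_K)$, $L^M_\lambda(f_K)$ and $A^M_\lambda(f_K)$ are globally Lipschitz continuous on $\mathbb{R}^n$, with Lipschitz constant at most $8\sqrt{M\lambda}$; (ii) $(SA)^M_{\lambda,\tau}(f_K)$ is a $C^{1,1}$ function on $\mathbb{R}^n$ (that is, continuously differentiable with globally Lipschitz derivative), and $$\big|(SA)^M_{\lambda,\tau}(f_K)(x)-A^M_\lambda(f_K)(x)\big|\le\frac{16M\lambda}{\tau}\qquad\text{for all }x\in\mathbb{R}^n.$$ -/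

import Mathlib

open scoped NNReal

noncomputable section

namespace CompensatedConvex

/-- The convex envelope `co[g]`: the pointwise supremum of all convex functions `h ≤ g`.
For a real-valued `g` that is bounded below the family of such `h` is non-empty and bounded above
by `g x` at every point `x`, so the supremum is a genuine one. -/
def convexEnvelope {n : ℕ} (g : EuclideanSpace ℝ (Fin n) → ℝ) (x : EuclideanSpace ℝ (Fin n)) : ℝ :=
  sSup {t : ℝ | ∃ h : EuclideanSpace ℝ (Fin n) → ℝ,
    ConvexOn ℝ Set.univ h ∧ (∀ y, h y ≤ g y) ∧ t = h x}

/-- The quadratic lower compensated convex transform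
`C^l_lam(f)(x) = co[lam |·|² + f](x) - lam |x|²`. -/
def lowerTransform {n : ℕ} (lam : ℝ) (f : EuclideanSpace ℝ (Fin n) → ℝ)
    (x : EuclideanSpace ℝ (Fin n)) : ℝ :=
  convexEnvelope (fun y => lam * ‖y‖ ^ 2 + f y) x - lam * ‖x‖ ^ 2

/-- The quadratic upper compensated convex transform
`C^u_lam(f)(x) = lam |x|² - co[lam |·|² - f](x)`. -/
def upperTransform {n : ℕ} (lam : ℝ) (f : EuclideanSpace ℝ (Fin n) → ℝ)
    (x : EuclideanSpace ℝ (Fin n)) : ℝ :=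
  lam * ‖x‖ ^ 2 - convexEnvelope (fun y => lam * ‖y‖ ^ 2 - f y) x

open Classical in
/-- The extension of a sampled function `fK : K → ℝ` to the whole space by the constant `c`
outside `K`; `f_K^M` is the case `c = M` and `f_K^{-M}` the case `c = -M`. -/
def constExtension {n : ℕ} {K : Set (EuclideanSpace ℝ (Fin n))} (fK : K → ℝ) (c : ℝ)
    (x : EuclideanSpace ℝ (Fin n)) : ℝ :=
  if hx : x ∈ K then fK ⟨x, hx⟩ else c

/-- The upper approximation `U^M_lam(f_K) = C^u_lam(f_K^{-M})`. -/
def upperApprox {n : ℕ} {K : Set (EuclideanSpace ℝ (Fin n))} (M lam : ℝ) (fK : K → ℝ)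
    (x : EuclideanSpace ℝ (Fin n)) : ℝ :=
  upperTransform lam (constExtension fK (-M)) x

/-- The lower approximation `L^M_lam(f_K) = C^l_lam(f_K^M)`. -/
def lowerApprox {n : ℕ} {K : Set (EuclideanSpace ℝ (Fin n))} (M lam : ℝ) (fK : K → ℝ)
    (x : EuclideanSpace ℝ (Fin n)) : ℝ :=
  lowerTransform lam (constExtension fK M) x

/-- The average approximation `A^M_lam(f_K) = (C^l_lam(f_K^M) + C^u_lam(f_K^{-M})) / 2`. -/
def averageApprox {n : ℕ} {K : Set (EuclideanSpace ℝ (Fin n))} (M lam : ℝ) (fK : K → ℝ)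
    (x : EuclideanSpace ℝ (Fin n)) : ℝ :=
  (1 / 2 : ℝ) * (lowerTransform lam (constExtension fK M) x
    + upperTransform lam (constExtension fK (-M)) x)

/-- The mixed average approximation, with inner scale `lam` and outer scale `tau`:
`(C^u_tau(C^l_lam(f_K^M)) + C^l_tau(C^u_lam(f_K^{-M}))) / 2`. -/
def mixedApprox {n : ℕ} {K : Set (EuclideanSpace ℝ (Fin n))} (M lam tau : ℝ) (fK : K → ℝ)
    (x : EuclideanSpace ℝ (Fin n)) : ℝ :=
  (1 / 2 : ℝ) * (upperTransform tau (lowerTransform lam (constExtension fK M)) x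
    + lowerTransform tau (upperTransform lam (constExtension fK (-M))) x)

/-- `g` is of class `C^{1,1}` on the whole space: it is continuously differentiable and its
derivative is globally Lipschitz. -/
def IsC11 {n : ℕ} (g : EuclideanSpace ℝ (Fin n) → ℝ) : Prop :=
  ContDiff ℝ 1 g ∧ ∃ L : ℝ≥0, LipschitzWith L (fderiv ℝ g)

end CompensatedConvex

end

open scoped NNReal

noncomputable section

namespace CompensatedConvex

/-! ### Semiconvex functions and their Lipschitz bounds. -/

section Semiconvex

variable {E : Type*} [NormedAddCommGroup E] [InnerProductSpace ℝ E]

/-! Semiconvexity controls everything. The lower transform of a function bounded by `M` is again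
bounded by `M` and semiconvex with constant `lam`; upper transforms are lower transforms up to sign.
Bounded semiconvex functions are Lipschitz with constant `3 * √(M * lam)` (`SemiconvexWith.sub_le`),
which gives (i).

For (ii), the outer transform adds semiconvexity with constant `tau` while keeping the semiconcavity
of its argument (`semiconvexWith_neg_lowerTransform`); two-sided semiconvexity forces `C^{1,1}`.
Transforming an `L`-Lipschitz function costs at most `L ^ 2 / (4 * tau)` (`le_lowerTransform_add`),
here `9 * M * lam / (4 * tau)`. -/

lemma convexCombo_norm_sq (x y : E) {a b : ℝ} (hab : a + b = 1) :
    ‖a • x + b • y‖ ^ 2 = a * ‖x‖ ^ 2 + b * ‖y‖ ^ 2 - a * b * ‖x - y‖ ^ 2 := by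
  rw [norm_add_sq_real, norm_sub_sq_real, norm_smul, norm_smul, real_inner_smul_left,
    inner_smul_right, mul_pow, mul_pow, Real.norm_eq_abs, Real.norm_eq_abs, sq_abs, sq_abs]
  obtain rfl := eq_sub_of_add_eq hab
  ring

/-- `f` is semiconvex with constant `A`: equivalently, `f + A ‖·‖ ^ 2` is convex. -/
def SemiconvexWith (A : ℝ) (f : E → ℝ) : Prop :=
  ∀ x y : E, ∀ a b : ℝ, 0 ≤ a → 0 ≤ b → a + b = 1 →
    f (a • x + b • y) ≤ a * f x + b * f y + A * (a * b) * ‖x - y‖ ^ 2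

lemma semiconvexWith_iff_convexOn {A : ℝ} {f : E → ℝ} :
    SemiconvexWith A f ↔ ConvexOn ℝ Set.univ (fun x => A * ‖x‖ ^ 2 + f x) := by
  constructor
  · intro h
    refine ⟨convex_univ, fun x _ y _ a b ha hb hab => ?_⟩
    have := h x y a b ha hb hab
    simp only [smul_eq_mul, convexCombo_norm_sq x y hab]
    linarith
  · intro h x y a b ha hb hab
    have := h.2 (Set.mem_univ x) (Set.mem_univ y) ha hb hab
    simp only [smul_eq_mul, convexCombo_norm_sq x y hab] at this
    linarith

lemma SemiconvexWith.mono {A B : ℝ} {f : E → ℝ} (h : SemiconvexWith A f) (hAB : A ≤ B) :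
    SemiconvexWith B f := by
  intro x y a b ha hb hab
  have h1 := h x y a b ha hb hab
  have h2 : A * (a * b) * ‖x - y‖ ^ 2 ≤ B * (a * b) * ‖x - y‖ ^ 2 := by gcongr
  linarith

lemma SemiconvexWith.average {A : ℝ} {f g : E → ℝ} (hf : SemiconvexWith A f)
    (hg : SemiconvexWith A g) : SemiconvexWith A (fun x => (1 / 2 : ℝ) * (f x + g x)) := by
  intro x y a b ha hb hab
  have h1 := hf x y a b ha hb hab
  have h2 := hg x y a b ha hb hab
  linarith

/-- A bounded semiconvex function is globally Lipschitz. -/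
lemma SemiconvexWith.sub_le {A M : ℝ} {p : E → ℝ} (hp : SemiconvexWith A p) (hA : 0 < A)
    (hM : 0 < M) (hb : ∀ x, |p x| ≤ M) (x y : E) :
    p y - p x ≤ 3 * Real.sqrt (M * A) * ‖y - x‖ := by
  rcases eq_or_ne y x with rfl | hxy
  · simp
  set R := Real.sqrt (M * A) with hR
  have hRpos : 0 < R := Real.sqrt_pos.2 (mul_pos hM hA)
  have hR2 : R ^ 2 = M * A := Real.sq_sqrt (mul_pos hM hA).le
  -- With overshoot `s`, the slope is bounded by `2 * M / s + A * s`; `s = √(M / A)` makes this `3 *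
  -- √(M * A)`.
  set s := R / A with hs
  have hspos : 0 < s := div_pos hRpos hA
  have hsA : A * s = R := by rw [hs]; field_simp
  have hMs : M = R * s := by rw [hs]; field_simp; linarith
  set d := ‖y - x‖ with hd
  have hdpos : 0 < d := norm_pos_iff.2 (sub_ne_zero.2 hxy)
  have hsd : 0 < s + d := by positivity
  -- `z` lies beyond `y` by distance `s` on the ray from `x`; semiconvexity is applied to `y`
  -- between `x` and `z`.
  set z := x + ((s + d) / d) • (y - x) with hz
  have hcomb : (s / (s + d)) • x + (d / (s + d)) • z = y := by
    have h1 : s / (s + d) + d / (s + d) = 1 := by field_simp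
    rw [hz, smul_add, smul_smul, ← add_assoc, ← add_smul, h1,
      show d / (s + d) * ((s + d) / d) = 1 by field_simp]
    simp
  have hxz : ‖x - z‖ = s + d := by
    rw [hz, sub_add_cancel_left, norm_neg, norm_smul, ← hd, Real.norm_eq_abs,
      abs_of_pos (by positivity)]
    field_simp
  have h := hp x z (s / (s + d)) (d / (s + d)) (by positivity) (by positivity) (by field_simp)
  rw [hcomb, hxz] at h
  have h1 : A * (s / (s + d) * (d / (s + d))) * (s + d) ^ 2 = R * d := by
    rw [← hsA]; field_simp
  have h2 : s / (s + d) * p x = p x - d / (s + d) * p x := by field_simp; ring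
  have h3 : d / (s + d) * (p z - p x) ≤ d / s * (2 * M) := by
    have hzx : p z - p x ≤ 2 * M := by linarith [(abs_le.1 (hb z)).2, (abs_le.1 (hb x)).1]
    calc d / (s + d) * (p z - p x) ≤ d / (s + d) * (2 * M) := by gcongr
      _ ≤ d / s * (2 * M) := by gcongr; linarith
  have h4 : d / s * (2 * M) = 2 * R * d := by rw [hMs]; field_simp
  linarith

lemma lipschitzWith_toNNReal_of_sub_le {X : Type*} [NormedAddCommGroup X] {C D : ℝ} {p : X → ℝ}
    (hCD : C ≤ D) (h : ∀ x y, p y - p x ≤ C * ‖y - x‖) : LipschitzWith (Real.toNNReal D) p := by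
  refine LipschitzWith.of_le_add_mul' D fun x y => ?_
  have h1 := h y x
  have h2 : C * ‖x - y‖ ≤ D * ‖x - y‖ := by gcongr
  rw [dist_eq_norm]
  linarith

end Semiconvex

/-! ### Two-sided semiconvexity implies `C^{1,1}`. -/

section Differentiability

/-- A convex function on a finite-dimensional space has a subgradient at every point. -/
lemma exists_subgradient {E : Type*} [NormedAddCommGroup E] [NormedSpace ℝ E]
    [FiniteDimensional ℝ E] {f : E → ℝ} (hf : ConvexOn ℝ Set.univ f) (x : E) :
    ∃ l : E →L[ℝ] ℝ, ∀ y, f x + l (y - x) ≤ f y := by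
  have hcont : Continuous f := hf.locallyLipschitz.continuous
  have hopen : IsOpen {p : E × ℝ | p.1 ∈ Set.univ ∧ f p.1 < p.2} := by
    simp only [Set.mem_univ, true_and]
    exact isOpen_lt (hcont.comp continuous_fst) continuous_snd
  obtain ⟨F, hF⟩ := geometric_hahn_banach_open_point (x := (x, f x)) hf.convex_strict_epigraph
    hopen (by simp)
  set G : E →L[ℝ] ℝ := F.comp (ContinuousLinearMap.inl ℝ E ℝ) with hG
  set c := F (0, 1) with hc
  have hsplit : ∀ (y : E) (t : ℝ), F (y, t) = G y + t * c := by
    intro y t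
    have : ((y, t) : E × ℝ) = (y, 0) + t • (0, 1) := by simp
    rw [this, map_add, map_smul, smul_eq_mul]
    rfl
  have key : ∀ (y : E) (t : ℝ), f y < t → G y + t * c < G x + f x * c := by
    intro y t ht
    rw [← hsplit, ← hsplit]
    exact hF (y, t) ⟨Set.mem_univ _, ht⟩
  -- The separating hyperplane is not vertical, so dividing by `c` turns it into a slope.
  have hcneg : c < 0 := by
    have := key x (f x + 1) (by linarith)
    linarith
  refine ⟨(-c⁻¹) • G, fun y => ?_⟩
  by_contra! hlt
  have := key y _ hlt
  rw [smul_apply, smul_eq_mul, map_sub] at this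
  have h2 : (f x + -c⁻¹ * (G y - G x)) * c = f x * c - (G y - G x) := by
    field_simp [hcneg.ne]
    ring
  rw [h2] at this
  linarith

variable {E : Type*} [NormedAddCommGroup E] [InnerProductSpace ℝ E]

/-- Along `t • v` the hypothesis is a quadratic in `t` that is never negative, and its discriminant
is `(l v - m v) ^ 2`. -/
lemma eq_of_sub_le_mul_norm_sq {l m : E →L[ℝ] ℝ} {A : ℝ}
    (h : ∀ v, l v - m v ≤ A * ‖v‖ ^ 2) : l = m := by
  ext v
  have := discrim_le_zero (a := A * ‖v‖ ^ 2) (b := -(l v - m v)) (c := 0) fun t => by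
    have h1 := h (t • v)
    rw [map_smul, map_smul, norm_smul, mul_pow, Real.norm_eq_abs, sq_abs, smul_eq_mul,
      smul_eq_mul] at h1
    linarith
  rw [discrim] at this
  nlinarith [sq_nonneg (l v - m v)]

variable [FiniteDimensional ℝ E]

lemma SemiconvexWith.exists_subgradient {A : ℝ} {f : E → ℝ} (hf : SemiconvexWith A f) (x : E) :
    ∃ l : E →L[ℝ] ℝ, ∀ y, f x + l (y - x) - A * ‖y - x‖ ^ 2 ≤ f y := by
  obtain ⟨l, hl⟩ := CompensatedConvex.exists_subgradient (semiconvexWith_iff_convexOn.1 hf) x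
  refine ⟨l - (2 * A) • innerSL ℝ x, fun y => ?_⟩
  have h := hl y
  have h2 : ‖y - x‖ ^ 2 = ‖y‖ ^ 2 - ‖x‖ ^ 2 - 2 * inner ℝ x (y - x) := by
    rw [norm_sub_sq_real, inner_sub_right, real_inner_self_eq_norm_sq, real_inner_comm]
    ring
  simp only [sub_apply, smul_apply, innerSL_apply_apply,
    smul_eq_mul, h2]
  linarith

/-- Subgradients of `f` and `-f` sum to a linear map bounded above by a quadratic, hence to zero;
the two one-sided bounds then share one slope. -/
lemma exists_taylor_of_semiconvexWith {A : ℝ} {f : E → ℝ} (hf : SemiconvexWith A f)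
    (hf' : SemiconvexWith A (fun x => -f x)) (x : E) :
    ∃ l : E →L[ℝ] ℝ, ∀ y, |f y - f x - l (y - x)| ≤ A * ‖y - x‖ ^ 2 := by
  obtain ⟨l, hl⟩ := hf.exists_subgradient x
  obtain ⟨m, hm⟩ := hf'.exists_subgradient x
  have hlm : l = -m := by
    refine eq_of_sub_le_mul_norm_sq (A := 2 * A) fun v => ?_
    have h1 := hl (x + v)
    have h2 := hm (x + v)
    simp only [add_sub_cancel_left, neg_apply] at *
    linarith
  refine ⟨l, fun y => abs_le.2 ⟨by linarith [hl y], ?_⟩⟩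
  have h2 := hm y
  rw [hlm, neg_apply]
  linarith

lemma contDiff_lipschitzWith_fderiv_of_semiconvexWith {A : ℝ} (hA : 0 ≤ A) {f : E → ℝ}
    (hf : SemiconvexWith A f) (hf' : SemiconvexWith A (fun x => -f x)) :
    ContDiff ℝ 1 f ∧ ∃ L : ℝ≥0, LipschitzWith L (fderiv ℝ f) := by
  choose l hl using exists_taylor_of_semiconvexWith hf hf'
  have hderiv : ∀ x, HasFDerivAt f (l x) x := by
    intro x
    refine HasFDerivAt.of_isLittleO ?_
    refine Asymptotics.IsBigO.trans_isLittleO (g := fun y => ‖y - x‖ ^ 2) ?_ ?_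
    · refine Asymptotics.IsBigO.of_bound A (Filter.Eventually.of_forall fun y => ?_)
      simpa using hl x y
    · have h := (Asymptotics.isLittleO_norm_pow_id (E' := E) one_lt_two)
      have ht : Filter.Tendsto (fun y => y - x) (nhds x) (nhds 0) := by
        simpa using (continuous_id.sub continuous_const).tendsto (f := fun y : E => y - x) x
      exact h.comp_tendsto ht
  have hfd : fderiv ℝ f = l := funext fun x => (hderiv x).fderiv
  have hlip : LipschitzWith (Real.toNNReal (6 * A)) (fderiv ℝ f) := by
    rw [hfd]
    refine LipschitzWith.of_dist_le' fun x y => ?_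
    rcases eq_or_ne x y with rfl | hxy
    · simp
    rw [dist_eq_norm, dist_eq_norm]
    set d := ‖x - y‖ with hd
    have hdpos : 0 < d := norm_pos_iff.2 (sub_ne_zero.2 hxy)
    -- Compare the expansions at `x` and `y` of the value at `y + w`: the errors are `A * (2 * d) ^
    -- 2` and twice `A * d ^ 2`.
    have key : ∀ w : E, ‖w‖ = d → l x w - l y w ≤ 6 * A * d ^ 2 := by
      intro w hw
      have h1 := (abs_le.1 (hl x (y + w))).1
      have h2 := (abs_le.1 (hl y (y + w))).2
      have h3 := (abs_le.1 (hl x y)).2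
      have hyx : ‖y - x‖ = d := by rw [hd, norm_sub_rev]
      rw [show y + w - x = (y - x) + w by abel, map_add] at h1
      rw [add_sub_cancel_left, hw] at h2
      rw [hyx] at h3
      have h4 : A * ‖y - x + w‖ ^ 2 ≤ A * (2 * d) ^ 2 := by
        gcongr
        exact (norm_add_le _ _).trans (by rw [hyx, hw]; linarith)
      nlinarith
    refine ContinuousLinearMap.opNorm_le_of_unit_norm (by positivity) fun v hv => ?_
    have hdv : ‖d • v‖ = d := by rw [norm_smul, hv, Real.norm_eq_abs, abs_of_pos hdpos, mul_one]
    have h1 := key (d • v) hdv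
    have h2 := key (-(d • v)) (by rw [norm_neg, hdv])
    simp only [map_neg, map_smul, smul_eq_mul] at h1 h2
    rw [sub_apply, Real.norm_eq_abs]
    refine abs_le.2 ⟨?_, ?_⟩
    · refine le_of_mul_le_mul_left ?_ hdpos
      linarith
    · refine le_of_mul_le_mul_left ?_ hdpos
      linarith
  exact ⟨contDiff_one_iff_fderiv.2 ⟨fun x => (hderiv x).differentiableAt, hlip.continuous⟩,
    _, hlip⟩

end Differentiability

/-! ### Convex envelopes. -/

section Envelope

variable {n : ℕ} {g h : EuclideanSpace ℝ (Fin n) → ℝ}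

/-- The minorant `h` rules out the empty supremum, whose default value is `0`. -/
lemma convexEnvelope_le (hh : ConvexOn ℝ Set.univ h) (hle : ∀ y, h y ≤ g y)
    (x : EuclideanSpace ℝ (Fin n)) : convexEnvelope g x ≤ g x := by
  refine csSup_le ⟨h x, h, hh, hle, rfl⟩ ?_
  rintro t ⟨k, -, hk, rfl⟩
  exact hk x

lemma le_convexEnvelope (hh : ConvexOn ℝ Set.univ h) (hle : ∀ y, h y ≤ g y)
    (x : EuclideanSpace ℝ (Fin n)) : h x ≤ convexEnvelope g x := by
  refine le_csSup ⟨g x, ?_⟩ ⟨h, hh, hle, rfl⟩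
  rintro t ⟨k, -, hk, rfl⟩
  exact hk x

lemma convexOn_convexEnvelope (hh : ConvexOn ℝ Set.univ h) (hle : ∀ y, h y ≤ g y) :
    ConvexOn ℝ Set.univ (convexEnvelope g) := by
  refine ⟨convex_univ, fun x _ y _ a b ha hb hab => ?_⟩
  refine csSup_le ⟨_, h, hh, hle, rfl⟩ ?_
  rintro t ⟨k, hk, hkg, rfl⟩
  refine (hk.2 (Set.mem_univ x) (Set.mem_univ y) ha hb hab).trans ?_
  simp only [smul_eq_mul]
  gcongr
  · exact le_convexEnvelope hk hkg x
  · exact le_convexEnvelope hk hkg y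

end Envelope

/-! ### Compensated transforms. -/

section LowerTransform

variable {n : ℕ} {f : EuclideanSpace ℝ (Fin n) → ℝ} {M lam : ℝ}

lemma upperTransform_eq_neg_lowerTransform (lam : ℝ) (f : EuclideanSpace ℝ (Fin n) → ℝ) :
    upperTransform lam f = fun x => -lowerTransform lam (fun y => -f y) x := by
  funext x
  simp only [upperTransform, lowerTransform, sub_eq_add_neg, neg_add, neg_neg]
  ring

lemma convexOn_mul_norm_sq_add_const (hlam : 0 ≤ lam) (c : ℝ) :
    ConvexOn ℝ Set.univ (fun x : EuclideanSpace ℝ (Fin n) => lam * ‖x‖ ^ 2 + c) := by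
  rw [← semiconvexWith_iff_convexOn (f := fun _ => c)]
  intro x y a b ha hb hab
  have : a * c + b * c = c := by rw [← add_mul, hab, one_mul]
  have : 0 ≤ lam * (a * b) * ‖x - y‖ ^ 2 := by positivity
  simp only
  linarith

lemma mul_norm_sq_sub_le (hf : ∀ x, |f x| ≤ M) (x : EuclideanSpace ℝ (Fin n)) :
    lam * ‖x‖ ^ 2 + -M ≤ lam * ‖x‖ ^ 2 + f x := by
  linarith [(abs_le.1 (hf x)).1]

lemma lowerTransform_le (hlam : 0 ≤ lam) (hf : ∀ x, |f x| ≤ M) (x : EuclideanSpace ℝ (Fin n)) :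
    lowerTransform lam f x ≤ f x := by
  have := convexEnvelope_le (convexOn_mul_norm_sq_add_const hlam (-M)) (mul_norm_sq_sub_le hf) x
  rw [lowerTransform]
  linarith

lemma abs_lowerTransform_le (hlam : 0 ≤ lam) (hf : ∀ x, |f x| ≤ M)
    (x : EuclideanSpace ℝ (Fin n)) : |lowerTransform lam f x| ≤ M := by
  refine abs_le.2 ⟨?_, (lowerTransform_le hlam hf x).trans (abs_le.1 (hf x)).2⟩
  have := le_convexEnvelope (convexOn_mul_norm_sq_add_const hlam (-M)) (mul_norm_sq_sub_le hf) x
  rw [lowerTransform]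
  linarith

lemma semiconvexWith_lowerTransform (hlam : 0 ≤ lam) (hf : ∀ x, |f x| ≤ M) :
    SemiconvexWith lam (lowerTransform lam f) := by
  rw [semiconvexWith_iff_convexOn]
  simpa only [lowerTransform, add_sub_cancel] using
    convexOn_convexEnvelope (convexOn_mul_norm_sq_add_const hlam (-M)) (mul_norm_sq_sub_le hf)

/-- The lower transform preserves semiconcavity. -/
lemma semiconvexWith_neg_lowerTransform {tau : ℝ} (htau : 0 ≤ tau) (hf : ∀ x, |f x| ≤ M)
    (hsc : SemiconvexWith lam (fun x => -f x)) :
    SemiconvexWith lam (fun x => -lowerTransform tau f x) := by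
  intro x y a b ha hb hab
  set E := convexEnvelope (fun y => tau * ‖y‖ ^ 2 + f y) with hE
  have hconv : ConvexOn ℝ Set.univ E :=
    convexOn_convexEnvelope (convexOn_mul_norm_sq_add_const htau (-M)) (mul_norm_sq_sub_le hf)
  have hle : ∀ w, E w ≤ tau * ‖w‖ ^ 2 + f w :=
    convexEnvelope_le (convexOn_mul_norm_sq_add_const htau (-M)) (mul_norm_sq_sub_le hf)
  obtain ⟨v, hv⟩ : ∃ v, v = x - y := ⟨_, rfl⟩
  set c := (tau + lam) * (a * b) * ‖v‖ ^ 2 with hc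
  -- A convex competitor for the envelope: averaging translates of `E` costs `tau * (a * b) * ‖v‖ ^
  -- 2` from the quadratic and `lam * (a * b) * ‖v‖ ^ 2` from semiconcavity of `f`, which `c`
  -- absorbs. At `a • x + b • y` the translates land on `x` and `y`.
  let F : EuclideanSpace ℝ (Fin n) → ℝ := fun w => a * E (w + b • v) + b * E (w - a • v) - c
  have hF : ConvexOn ℝ Set.univ F := by
    refine ⟨convex_univ, fun p _ q _ s t hs ht hst => ?_⟩
    have h1 := hconv.2 (Set.mem_univ (p + b • v)) (Set.mem_univ (q + b • v)) hs ht hst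
    have h2 := hconv.2 (Set.mem_univ (p - a • v)) (Set.mem_univ (q - a • v)) hs ht hst
    have e1 : s • (p + b • v) + t • (q + b • v) = s • p + t • q + b • v := by
      rw [smul_add, smul_add, add_add_add_comm, ← add_smul, hst, one_smul]
    have e2 : s • (p - a • v) + t • (q - a • v) = s • p + t • q - a • v := by
      rw [smul_sub, smul_sub, sub_add_sub_comm, ← add_smul, hst, one_smul]
    rw [e1, smul_eq_mul, smul_eq_mul] at h1
    rw [e2, smul_eq_mul, smul_eq_mul] at h2
    have h3 := mul_le_mul_of_nonneg_left h1 ha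
    have h4 := mul_le_mul_of_nonneg_left h2 hb
    have h5 : s * c + t * c = c := by rw [← add_mul, hst, one_mul]
    simp only [F, smul_eq_mul]
    linarith
  have hFle : ∀ w, F w ≤ tau * ‖w‖ ^ 2 + f w := by
    intro w
    have e : a • (w + b • v) + b • (w - a • v) = w := by
      rw [smul_add, smul_sub, smul_smul, smul_smul, mul_comm b a, add_add_sub_cancel, ← add_smul,
        hab, one_smul]
    have e' : w + b • v - (w - a • v) = v := by
      rw [add_sub_sub_cancel, ← add_smul, add_comm b a, hab, one_smul]
    have h1 := mul_le_mul_of_nonneg_left (hle (w + b • v)) ha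
    have h2 := mul_le_mul_of_nonneg_left (hle (w - a • v)) hb
    have h3 := hsc (w + b • v) (w - a • v) a b ha hb hab
    have h4 := convexCombo_norm_sq (w + b • v) (w - a • v) hab
    rw [e, e'] at h3 h4
    rw [h4]
    simp only [F, hc]
    linarith
  have hz := le_convexEnvelope hF hFle (a • x + b • y)
  have ex : a • x + b • y + b • v = x := by
    rw [hv, smul_sub, add_add_sub_cancel, ← add_smul, hab, one_smul]
  have ey : a • x + b • y - a • v = y := by
    rw [hv, smul_sub, add_sub_sub_cancel, add_comm, ← add_smul, hab, one_smul]
  simp only [F, ex, ey, ← hE] at hz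
  have hn := convexCombo_norm_sq x y hab
  simp only [lowerTransform, ← hE]
  rw [hn, ← hv]
  simp only [hc] at hz
  linarith

lemma le_lowerTransform_add {tau L : ℝ} (htau : 0 < tau) (hf : ∀ x y, f y - f x ≤ L * ‖y - x‖)
    (x : EuclideanSpace ℝ (Fin n)) : f x ≤ lowerTransform tau f x + L ^ 2 / (4 * tau) := by
  -- The quadratics cancel, so `h` is affine; it is a minorant since `L * r - tau * r ^ 2` has
  -- maximum `L ^ 2 / (4 * tau)`.
  let h : EuclideanSpace ℝ (Fin n) → ℝ := fun y =>
    tau * ‖y‖ ^ 2 + (f x - tau * ‖y - x‖ ^ 2 - L ^ 2 / (4 * tau))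
  have hconv : ConvexOn ℝ Set.univ h := by
    rw [← semiconvexWith_iff_convexOn
      (f := fun y => f x - tau * ‖y - x‖ ^ 2 - L ^ 2 / (4 * tau))]
    intro p q a b ha hb hab
    have e : a • p + b • q - x = a • (p - x) + b • (q - x) := by
      rw [smul_sub, smul_sub, sub_add_sub_comm, ← add_smul, hab, one_smul]
    have h1 := convexCombo_norm_sq (p - x) (q - x) hab
    rw [sub_sub_sub_cancel_right] at h1
    simp only [e, h1]
    obtain rfl := eq_sub_of_add_eq hab
    apply le_of_eq
    ring
  have hle : ∀ y, h y ≤ tau * ‖y‖ ^ 2 + f y := by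
    intro y
    have h1 := hf y x
    rw [norm_sub_rev] at h1
    have h2 : L * ‖y - x‖ ≤ tau * ‖y - x‖ ^ 2 + L ^ 2 / (4 * tau) := by
      have : tau * ‖y - x‖ ^ 2 + L ^ 2 / (4 * tau) - L * ‖y - x‖
          = (2 * tau * ‖y - x‖ - L) ^ 2 / (4 * tau) := by
        field_simp
        ring
      have : 0 ≤ (2 * tau * ‖y - x‖ - L) ^ 2 / (4 * tau) := by positivity
      linarith
    simp only [h]
    linarith
  have := le_convexEnvelope hconv hle x
  simp only [h, sub_self, norm_zero] at this
  rw [lowerTransform]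
  linarith

/-- The properties of the mixed transform `C^l_tau(-C^l_lam(f))` used for both halves of the mixed
approximation. -/
lemma lowerTransform_neg_lowerTransform {tau : ℝ} (hlam : 0 < lam) (htau : 0 < tau) (hM : 0 < M)
    (hf : ∀ x, |f x| ≤ M) :
    SemiconvexWith (lam + tau) (lowerTransform tau (fun y => -lowerTransform lam f y)) ∧
    SemiconvexWith (lam + tau) (fun x => -lowerTransform tau (fun y => -lowerTransform lam f y) x) ∧
    ∀ x, |lowerTransform tau (fun y => -lowerTransform lam f y) x - -lowerTransform lam f x|
      ≤ 16 * M * lam / tau := by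
  have hsc := semiconvexWith_lowerTransform hlam.le hf
  have hb := abs_lowerTransform_le hlam.le hf
  have hb' : ∀ x, |(-lowerTransform lam f x)| ≤ M := fun x => by rw [abs_neg]; exact hb x
  refine ⟨(semiconvexWith_lowerTransform htau.le hb').mono (by linarith),
    (semiconvexWith_neg_lowerTransform htau.le hb' (by simpa only [neg_neg] using hsc)).mono
      (by linarith), fun x => ?_⟩
  have h1 := lowerTransform_le htau.le hb' x
  have h2 := le_lowerTransform_add (f := fun y => -lowerTransform lam f y)
    (L := 3 * Real.sqrt (M * lam)) htau (fun x y => by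
    have := hsc.sub_le hlam hM hb y x
    rw [norm_sub_rev] at this
    linarith) x
  have h3 : (3 * Real.sqrt (M * lam)) ^ 2 / (4 * tau) ≤ 16 * M * lam / tau := by
    rw [mul_pow, Real.sq_sqrt (mul_pos hM hlam).le, div_le_div_iff₀ (by positivity) htau]
    nlinarith [mul_pos (mul_pos hM hlam) htau]
  have h4 : 0 ≤ 16 * M * lam / tau := by positivity
  exact abs_le.2 ⟨by linarith, by linarith⟩

lemma abs_constExtension_le {K : Set (EuclideanSpace ℝ (Fin n))} {fK : K → ℝ} {c : ℝ}
    (hf : ∀ x, |fK x| ≤ M) (hc : |c| ≤ M) (x : EuclideanSpace ℝ (Fin n)) :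
    |constExtension fK c x| ≤ M := by
  unfold constExtension
  split_ifs
  · exact hf _
  · exact hc

end LowerTransform

end CompensatedConvex

end

/-! ### Assembly. -/

theorem mainTheorem6 (n : ℕ) (K : Set (EuclideanSpace ℝ (Fin n))) (hKne : K.Nonempty)
    (hK : IsClosed K) (fK : K → ℝ) (M : ℝ) (hfM : ∀ x : K, |fK x| < M)
    (lam tau : ℝ) (hlam : 0 < lam) (htau : 0 < tau) :
    (LipschitzWith (Real.toNNReal (8 * Real.sqrt (M * lam)))
        (CompensatedConvex.upperApprox M lam fK) ∧
      LipschitzWith (Real.toNNReal (8 * Real.sqrt (M * lam)))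
        (CompensatedConvex.lowerApprox M lam fK) ∧
      LipschitzWith (Real.toNNReal (8 * Real.sqrt (M * lam)))
        (CompensatedConvex.averageApprox M lam fK)) ∧
    (CompensatedConvex.IsC11 (CompensatedConvex.mixedApprox M lam tau fK) ∧
      ∀ x : EuclideanSpace ℝ (Fin n),
        |CompensatedConvex.mixedApprox M lam tau fK x - CompensatedConvex.averageApprox M lam fK x|
          ≤ 16 * M * lam / tau) := by
  open CompensatedConvex in
  obtain ⟨x₀, hx₀⟩ := hKne
  have hM : 0 < M := (abs_nonneg _).trans_lt (hfM ⟨x₀, hx₀⟩)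
  set u := constExtension fK M with hu_def
  set w := constExtension fK (-M) with hw_def
  have hu : ∀ x, |u x| ≤ M :=
    abs_constExtension_le (fun x => (hfM x).le) (abs_of_pos hM).le
  have hw : ∀ x, |(-w x)| ≤ M := fun x => by
    rw [abs_neg]
    exact abs_constExtension_le (fun x => (hfM x).le) (by rw [abs_neg, abs_of_pos hM]) x
  set p := lowerTransform lam u with hp
  set q := lowerTransform lam (fun y => -w y) with hq
  have hupper : upperTransform lam w = fun x => -q x := upperTransform_eq_neg_lowerTransform lam w
  have hpL : ∀ x y, p y - p x ≤ 3 * Real.sqrt (M * lam) * ‖y - x‖ :=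
    (semiconvexWith_lowerTransform hlam.le hu).sub_le hlam hM (abs_lowerTransform_le hlam.le hu)
  have hqL : ∀ x y, -q y - -q x ≤ 3 * Real.sqrt (M * lam) * ‖y - x‖ := fun x y => by
    have := (semiconvexWith_lowerTransform hlam.le hw).sub_le hlam hM
      (abs_lowerTransform_le hlam.le hw) y x
    rw [norm_sub_rev] at this
    linarith
  have hconst : 3 * Real.sqrt (M * lam) ≤ 8 * Real.sqrt (M * lam) := by gcongr; norm_num
  have hU : upperApprox M lam fK = fun x => -q x := hupper
  have hL : lowerApprox M lam fK = p := rfl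
  have hA : averageApprox M lam fK = fun x => (1 / 2 : ℝ) * (p x + -q x) := by
    funext x
    rw [averageApprox, ← hw_def, hupper]
  have hS : mixedApprox M lam tau fK = fun x => (1 / 2 : ℝ) *
      (-lowerTransform tau (fun y => -p y) x + lowerTransform tau (fun y => -q y) x) := by
    funext x
    rw [mixedApprox, ← hw_def, hupper, upperTransform_eq_neg_lowerTransform]
  obtain ⟨p1, p2, p3⟩ := lowerTransform_neg_lowerTransform hlam htau hM hu
  obtain ⟨q1, q2, q3⟩ := lowerTransform_neg_lowerTransform hlam htau hM hw
  rw [hU, hL, hA, hS]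
  refine ⟨⟨lipschitzWith_toNNReal_of_sub_le hconst hqL,
    lipschitzWith_toNNReal_of_sub_le hconst hpL,
    lipschitzWith_toNNReal_of_sub_le hconst fun x y => ?_⟩, ?_, fun x => ?_⟩
  · linarith [hpL x y, hqL x y]
  -- The first half enters with a minus sign, so its semiconcavity pairs with the semiconvexity of
  -- the second.
  · refine contDiff_lipschitzWith_fderiv_of_semiconvexWith (A := lam + tau) (by positivity)
      (p2.average q1) ?_
    convert p1.average q2 using 2 with x
    ring
  · have hp3 := abs_le.1 (p3 x)
    have hq3 := abs_le.1 (q3 x)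
    exact abs_le.2 ⟨by linarith, by linarith⟩
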